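/- Let $\mathbb F_q$ be a finite field and let $\ell,n_1,\dots,n_\ell,m_1,\dots,m_\ell$ be positive integers with $m_1\ge\dots\ge m_\ell$ and $n_i\le m_i$ for all $i$. Let $\mathbb M=\mathbb F_q^{m_1\times n_1}\times\dots\times\mathbb F_q^{m_\ell\times n_\ell}$. For $C=(C_1,\dots,C_\ell)\in\mathbb M$ let $\mathrm{srk}(C)=\sum_{i=1}^\ell \mathrm{rk}(C_i)$. For an $\mathbb F_q$-linear subspace $\mathcal C\subseteq\mathbb M$ (a code) let $\mathrm{maxsrk}(\mathcal C)=\max\{\mathrm{srk}(C): C\in\mathcal C\}$ and, if $\mathcal C\ne 0$, let $d(\mathcal C)=\min\{\mathrm{srk}(C): C\in\mathcal C\setminus\{0\}\}$ be its minimum distance. An $\mathbb F_q$-linear subspace $\mathcal A_i\subseteq\mathbb F_q^{m_i\times n_i}$ is an optimal anticode if $\dim(\mathcal A_i)=m_i\max\{\mathrm{rk}(A): A\in\mathcal A_i\}$. For $1\le r\le\dim(\mathcal C)$ the $r$-th generalized sum-rank weight of $\mathcal C$ is $$d_r(\mathcal C)=\min\{\mathrm{maxsrk}(\mathcal A):\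 \mathcal A=\mathcal A_1\times\dots\times\mathcal A_\ell,\ \mathcal A_i\subseteq\mathbb F_q^{m_i\times n_i}\text{ optimal anticodes},\ \dim(\mathcal C\cap\mathcal A)\ge r\}.$$ Let $0\ne\mathcal C\subseteq\mathcal D\subseteq\mathbb M$ be codes. Then: 1. $d_1(\mathcal C)=d(\mathcal C)$. 2. $d_r(\mathcal C)\le d_s(\mathcal C)$ for all $1\le r\le s\le\dim(\mathcal C)$. 3. $d_r(\mathcal C)\ge d_r(\mathcal D)$ for all $1\le r\le\dim(\mathcal C)$. 4. $d_{\dim(\mathcal C)}(\mathcal C)\le n_1+\dots+n_\ell$. 5. For all $1\le j\le\ell$, all $0\le\delta\le n_j-1$ and all $r\ge 1$ with $r+\sum_{i<j}n_im_i+\delta m_j\le\dim(\mathcal C)$, $$d_{r+\sum_{i<j}n_im_i+\delta m_j}(\mathcal C)\ \ge\ d_r(\mathcal C)+\sum_{i<j}n_i+\delta.$$ -/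

import Mathlib

namespace SumRank

/-- The ambient space `𝔽^{m₁×n₁} × ⋯ × 𝔽^{m_ℓ×n_ℓ}` (blocks indexed from `0` to `ℓ - 1`). -/
abbrev Ambient (F : Type*) {ℓ : ℕ} (m n : Fin ℓ → ℕ) : Type _ :=
  (i : Fin ℓ) → Matrix (Fin (m i)) (Fin (n i)) F

variable {F : Type*} [Field F]

/-- The maximum rank of an element of a linear rank-metric code. -/
noncomputable def maxRank {a b : ℕ} (A : Submodule F (Matrix (Fin a) (Fin b) F)) : ℕ :=
  sSup {k | ∃ M ∈ A, M.rank = k}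

/-- A linear rank-metric code in `𝔽^{a×b}` (with `b ≤ a`) is an optimal anticode if it meets the
anticode bound `dim A ≤ a · maxRank A`. -/
def IsOptimalAnticode {a b : ℕ} (A : Submodule F (Matrix (Fin a) (Fin b) F)) : Prop :=
  Module.finrank F A = a * maxRank A

variable {ℓ : ℕ} {m n : Fin ℓ → ℕ}

/-- The sum-rank weight. -/
noncomputable def srk (X : Ambient F m n) : ℕ := ∑ i, (X i).rank

/-- The minimum distance of a (nonzero) linear sum-rank metric code. -/
noncomputable def minDist (C : Submodule F (Ambient F m n)) : ℕ :=
  sInf {k | ∃ X ∈ C, X ≠ 0 ∧ srk X = k}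

/-- The maximum sum-rank distance of a linear sum-rank metric code. -/
noncomputable def maxSrk (C : Submodule F (Ambient F m n)) : ℕ :=
  sSup {k | ∃ X ∈ C, srk X = k}

/-- The values `maxSrk (A₁ × ⋯ × A_ℓ)`, where the `A_i` are optimal rank-metric anticodes and
`dim (C ∩ (A₁ × ⋯ × A_ℓ)) ≥ r`. -/
def weightSet (C : Submodule F (Ambient F m n)) (r : ℕ) : Set ℕ :=
  {k | ∃ A : (i : Fin ℓ) → Submodule F (Matrix (Fin (m i)) (Fin (n i)) F),
    (∀ i, IsOptimalAnticode (A i)) ∧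
    r ≤ Module.finrank F ↥(C ⊓ Submodule.pi Set.univ A) ∧
    maxSrk (Submodule.pi Set.univ A) = k}

/-- The `r`-th generalized sum-rank weight `d_r(C)`, for `1 ≤ r ≤ dim C`. -/
noncomputable def genWeight (C : Submodule F (Ambient F m n)) (r : ℕ) : ℕ :=
  sInf (weightSet C r)

/-! The maxima and minima above are attained. -/

theorem isGreatest_maxRank {a b : ℕ} (A : Submodule F (Matrix (Fin a) (Fin b) F)) :
    IsGreatest {k | ∃ M ∈ A, M.rank = k} (maxRank A) := by
  have hb : BddAbove {k | ∃ M ∈ A, M.rank = k} := by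
    refine ⟨b, ?_⟩
    rintro k ⟨M, -, rfl⟩
    exact M.rank_le_width
  exact ⟨Nat.sSup_mem ⟨_, 0, A.zero_mem, rfl⟩ hb, fun k hk => le_csSup hb hk⟩

theorem isGreatest_maxSrk (C : Submodule F (Ambient F m n)) :
    IsGreatest {k | ∃ X ∈ C, srk X = k} (maxSrk C) := by
  have hb : BddAbove {k | ∃ X ∈ C, srk X = k} := by
    refine ⟨∑ i, n i, ?_⟩
    rintro k ⟨X, -, rfl⟩
    exact Finset.sum_le_sum fun i _ => (X i).rank_le_width
  exact ⟨Nat.sSup_mem ⟨_, 0, C.zero_mem, rfl⟩ hb, fun k hk => le_csSup hb hk⟩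

theorem isLeast_minDist (C : Submodule F (Ambient F m n)) (hC : C ≠ ⊥) :
    IsLeast {k | ∃ X ∈ C, X ≠ 0 ∧ srk X = k} (minDist C) := by
  obtain ⟨X, hX, h0⟩ := C.exists_mem_ne_zero_of_ne_bot hC
  exact ⟨Nat.sInf_mem ⟨_, X, hX, h0, rfl⟩, fun k hk => Nat.sInf_le hk⟩

theorem isOptimalAnticode_top {a b : ℕ} (h : b ≤ a) :
    IsOptimalAnticode (⊤ : Submodule F (Matrix (Fin a) (Fin b) F)) := by
  have hr : maxRank (⊤ : Submodule F (Matrix (Fin a) (Fin b) F)) = b := by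
    refine le_antisymm ?_ ?_
    · obtain ⟨M, -, hM⟩ := (isGreatest_maxRank
        (⊤ : Submodule F (Matrix (Fin a) (Fin b) F))).1
      exact hM ▸ M.rank_le_width
    · refine (isGreatest_maxRank _).2
        ⟨(1 : Matrix (Fin a) (Fin a) F).submatrix id (Fin.castLE h), trivial, ?_⟩
      have hl : LinearIndependent F
          ((1 : Matrix (Fin a) (Fin a) F).submatrix id (Fin.castLE h)).col := by
        have h1 : LinearIndependent F (1 : Matrix (Fin a) (Fin a) F).col :=
          Matrix.linearIndependent_cols_of_isUnit isUnit_one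
        exact h1.comp _ (Fin.castLE_injective h)
      rw [← Matrix.rank_transpose]
      have h2 := LinearIndependent.rank_matrix
        (M := ((1 : Matrix (Fin a) (Fin a) F).submatrix id (Fin.castLE h)).transpose) hl
      simpa using h2
  rw [IsOptimalAnticode, hr, finrank_top, Module.finrank_matrix]
  simp

theorem isLeast_genWeight (h : ∀ i, n i ≤ m i) (C : Submodule F (Ambient F m n)) {r : ℕ}
    (hr : r ≤ Module.finrank F C) : IsLeast (weightSet C r) (genWeight C r) := by
  refine ⟨Nat.sInf_mem ⟨_, fun _ => ⊤, fun i => isOptimalAnticode_top (h i), ?_, rfl⟩,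
    fun k hk => Nat.sInf_le hk⟩
  have ht : (Submodule.pi Set.univ fun _ => ⊤ : Submodule F (Ambient F m n)) = ⊤ := by
    ext X
    simp
  rwa [ht, inf_top_eq]

end SumRank

namespace SumRank

open Matrix

/-! Only item 5 is deep. Take a product `A` attaining the larger weight and lower the maximum rank
of its factors by `τ i`, with the `τ i` summing to the claimed gain. If the smaller factors are
again optimal anticodes, this costs dimension `∑ m i * τ i`, which for decreasing `m` is largest
when filled from the left (`sum_mul_le_of_antitone`). So the smaller product still meets `C` in
dimension at least `r`.

The crux is that an optimal anticode contains one of maximum rank one less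
(`IsOptimalAnticode.exists_sub_pred`). Leading positions of its elements in distinct rows and
columns number at most the maximum rank, so by König's theorem few lines cover all leading
positions. Optimality forces the lines to be all columns, or all rows in the square case. A linear
map preserving spans is a fixed combination, so the remaining columns are fixed combinations of the
covering ones; killing one covering column then lowers the rank. -/

theorem det_ne_zero_of_injective_order {F ι β : Type*} [Field F] [Fintype ι] [DecidableEq ι]
    [LinearOrder β] (N : Matrix ι ι F) (f : ι → β) (hf : Function.Injective f)
    (h0 : ∀ i s, f s < f i → N i s = 0) (h1 : ∀ i, N i i ≠ 0) : N.det ≠ 0 := by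
  let _ : LinearOrder ι := LinearOrder.lift' f hf
  have h := det_of_isUpperTriangular (M := N) (fun i s his => h0 i s his)
  have h' : N.det = ∏ i, N i i := by convert h
  rw [h']
  exact Finset.prod_ne_zero_iff.2 fun i _ => h1 i

/-! ### Leading positions and rank. -/

variable {F : Type*} [Field F] {a b : ℕ}

theorem rank_le_maxRank {A : Submodule F (Matrix (Fin a) (Fin b) F)} {M : Matrix (Fin a) (Fin b) F}
    (hM : M ∈ A) : M.rank ≤ maxRank A :=
  (isGreatest_maxRank A).2 ⟨M, hM, rfl⟩

theorem maxRank_le {A : Submodule F (Matrix (Fin a) (Fin b) F)} {r : ℕ}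
    (h : ∀ M ∈ A, M.rank ≤ r) : maxRank A ≤ r := by
  obtain ⟨M, hM, hr⟩ := (isGreatest_maxRank A).1
  exact hr ▸ h M hM

/-- Matrices of a linear space whose leading positions (in the row-by-row order) lie in pairwise
distinct rows and pairwise distinct columns have a combination of large rank. -/
theorem card_le_maxRank_of_leading {ι : Type*} [Fintype ι]
    (A : Submodule F (Matrix (Fin a) (Fin b) F)) (row : ι → Fin a) (col : ι → Fin b)
    (hrow : Function.Injective row) (hcol : Function.Injective col)
    (M : ι → Matrix (Fin a) (Fin b) F) (hA : ∀ t, M t ∈ A)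
    (habove : ∀ t, ∀ i < row t, ∀ j, M t i j = 0)
    (hleft : ∀ t, ∀ j < col t, M t (row t) j = 0)
    (hlead : ∀ t, M t (row t) (col t) ≠ 0) : Fintype.card ι ≤ maxRank A := by
  classical
  -- Rows above `u` come from one common combination, the others still from their own `M t`. For `u
  -- = 0` the matrix is triangular when ordered by `col`; for `u = a` it is a submatrix of one
  -- element of `A`.
  have key : ∀ u : ℕ, ∃ c : ι → F, (Matrix.of fun t s =>
      if (row t : ℕ) < u then ∑ x, c x * M x (row t) (col s)
      else M t (row t) (col s)).det ≠ 0 := by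
    intro u
    induction u with
    | zero =>
      refine ⟨0, det_ne_zero_of_injective_order _ col hcol ?_ ?_⟩
      · intro t s hts
        simpa using hleft t _ hts
      · intro t
        simpa using hlead t
    | succ u ih =>
      obtain ⟨c, hc⟩ := ih
      by_cases hu : ∃ t₀, (row t₀ : ℕ) = u
      · obtain ⟨t₀, ht₀⟩ := hu
        set G : Matrix ι ι F := Matrix.of fun t s =>
          if (row t : ℕ) < u then ∑ x, c x * M x (row t) (col s) else M t (row t) (col s) with hG
        let v : ι → F := fun s => M t₀ (row t₀) (col s)
        let w : ι → F := fun s => ∑ x, c x * M x (row t₀) (col s)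
        have hv : G.updateRow t₀ v = G := by
          have : v = G t₀ := by
            ext s
            simp [v, hG, ht₀]
          rw [this, updateRow_eq_self]
        -- Changing the coefficient at `t₀` leaves the rows already treated intact, because `M t₀`
        -- vanishes above `row t₀`.
        have hnew : ∀ y : F, (Matrix.of fun t s =>
            if (row t : ℕ) < u + 1 then
              ∑ x, (c x + if x = t₀ then y else 0) * M x (row t) (col s)
            else M t (row t) (col s)) = G.updateRow t₀ (w + y • v) := by
          intro y
          have hsum : ∀ i j, ∑ x, (c x + if x = t₀ then y else 0) * M x i j
              = ∑ x, c x * M x i j + y * M t₀ i j := by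
            intro i j
            simp [add_mul, Finset.sum_add_distrib]
          ext t s
          by_cases ht : t = t₀
          · subst ht
            simp [hsum, ht₀, w, v]
          · have hne : (row t : ℕ) ≠ u := fun h =>
              ht (hrow (Fin.ext (h.trans ht₀.symm)))
            rw [updateRow_ne ht]
            by_cases hlt : (row t : ℕ) < u
            · have h0 : M t₀ (row t) (col s) = 0 :=
                habove t₀ _ (by rw [Fin.lt_def]; omega) _
              have h1 : (row t : ℕ) < u + 1 := by omega
              simp only [of_apply, hG, if_pos hlt, if_pos h1, hsum, h0, mul_zero, add_zero]
            · have h1 : ¬ (row t : ℕ) < u + 1 := by omega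
              simp only [of_apply, hG, if_neg hlt, if_neg h1]
        have hdet : ∀ y : F, (G.updateRow t₀ (w + y • v)).det
            = (G.updateRow t₀ w).det + y * G.det := by
          intro y
          rw [det_updateRow_add, det_updateRow_smul, hv]
        -- The determinant is affine in `y` with slope `G.det ≠ 0`, so `y = 0` or `y = 1` works over
        -- every field.
        by_cases hw : (G.updateRow t₀ w).det = 0
        · refine ⟨fun x => c x + if x = t₀ then 1 else 0, ?_⟩
          rw [hnew, hdet, hw]
          simpa using hc
        · refine ⟨fun x => c x + if x = t₀ then 0 else 0, ?_⟩
          rw [hnew, hdet]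
          simpa using hw
      · refine ⟨c, ?_⟩
        convert hc using 5 with t s
        have : (row t : ℕ) ≠ u := fun h => hu ⟨t, h⟩
        exact if_congr (by omega) rfl rfl
  obtain ⟨c, hc⟩ := key a
  have hmem : ∑ x, c x • M x ∈ A := A.sum_mem fun x _ => A.smul_mem _ (hA x)
  have hsub : (∑ x, c x • M x).submatrix row col = Matrix.of fun t s =>
      if (row t : ℕ) < a then ∑ x, c x * M x (row t) (col s) else M t (row t) (col s) := by
    ext t s
    simp [Matrix.sum_apply]
  calc Fintype.card ι = ((∑ x, c x • M x).submatrix row col).rank := by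
        rw [hsub, rank_of_det_ne_zero hc]
    _ ≤ (∑ x, c x • M x).rank := rank_submatrix_le _ _ _
    _ ≤ maxRank A := rank_le_maxRank hmem

/-- The leading positions, in the row-by-row order, of the elements of a space of matrices. -/
def leadingPositions (A : Submodule F (Matrix (Fin a) (Fin b) F)) : Set (Fin a × Fin b) :=
  {p | ∃ M ∈ A, (∀ i < p.1, ∀ j, M i j = 0) ∧ (∀ j < p.2, M p.1 j = 0) ∧ M p.1 p.2 ≠ 0}

theorem exists_leadingPosition {A : Submodule F (Matrix (Fin a) (Fin b) F)}
    {M : Matrix (Fin a) (Fin b) F} (hM : M ∈ A) (h0 : M ≠ 0) :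
    ∃ p ∈ leadingPositions A, M p.1 p.2 ≠ 0 := by
  classical
  have h : ∃ i, ∃ j, M i j ≠ 0 := by
    by_contra! h
    exact h0 (Matrix.ext h)
  obtain ⟨i, hi, hi'⟩ := WellFounded.has_min (wellFounded_lt (α := Fin a)) {i | ∃ j, M i j ≠ 0} h
  obtain ⟨j, hj, hj'⟩ := WellFounded.has_min (wellFounded_lt (α := Fin b)) {j | M i j ≠ 0} hi
  refine ⟨(i, j), ⟨M, hM, ?_, ?_, hj⟩, hj⟩
  · intro i' hlt j'
    by_contra hne
    exact hi' i' ⟨j', hne⟩ hlt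
  · intro j' hlt
    by_contra hne
    exact hj' j' hne hlt

/-- An element vanishing at all leading positions has no leading entry of its own, so reading off
these entries is injective. -/
theorem finrank_le_ncard_leadingPositions (A : Submodule F (Matrix (Fin a) (Fin b) F)) :
    Module.finrank F A ≤ (leadingPositions A).ncard := by
  classical
  let f : A →ₗ[F] (leadingPositions A → F) :=
    { toFun := fun M p => M.1 p.1.1 p.1.2
      map_add' := fun _ _ => rfl
      map_smul' := fun _ _ => rfl }
  have hf : Function.Injective f := by
    rw [← LinearMap.ker_eq_bot, LinearMap.ker_eq_bot']
    rintro ⟨M, hM⟩ h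
    by_contra hne
    obtain ⟨p, hp, hp'⟩ := exists_leadingPosition hM (fun h => hne (Subtype.ext h))
    exact hp' (congrFun h ⟨p, hp⟩)
  have := LinearMap.finrank_le_finrank_of_injective hf
  rwa [Module.finrank_fintype_fun_eq_card, ← Nat.card_eq_fintype_card,
    Nat.card_coe_set_eq] at this

theorem card_le_maxRank_of_matching {ι : Type*} [Fintype ι]
    (A : Submodule F (Matrix (Fin a) (Fin b) F)) (row : ι → Fin a) (col : ι → Fin b)
    (hrow : Function.Injective row) (hcol : Function.Injective col)
    (h : ∀ t, (row t, col t) ∈ leadingPositions A) : Fintype.card ι ≤ maxRank A := by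
  choose M hA h1 h2 h3 using h
  exact card_le_maxRank_of_leading A row col hrow hcol M hA h1 h2 h3

/-! ### Line covers and the anticode bound. -/

/-- A form of König's theorem. -/
theorem exists_cover_of_matching_le {r : ℕ} (P : Set (Fin a × Fin b))
    (h : ∀ S : Finset (Fin b), ∀ row : S → Fin a, Function.Injective row →
      (∀ t, (row t, (t : Fin b)) ∈ P) → S.card ≤ r) :
    ∃ (I : Finset (Fin a)) (J : Finset (Fin b)), I.card + J.card ≤ r ∧
      ∀ p ∈ P, p.1 ∈ I ∨ p.2 ∈ J := by
  classical
  let N : Fin b → Finset (Fin a) := fun j => Finset.univ.filter fun i => (i, j) ∈ P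
  -- The cover consists of the rows adjacent to `S` and the columns outside `S`.
  suffices hS : ∃ S : Finset (Fin b), (S.biUnion N).card + (b - S.card) ≤ r by
    obtain ⟨S, hS⟩ := hS
    refine ⟨S.biUnion N, Sᶜ, by simpa [Finset.card_compl] using hS, ?_⟩
    rintro ⟨i, j⟩ hp
    by_cases hj : j ∈ S
    · left
      simp only [Finset.mem_biUnion]
      exact ⟨j, hj, by simpa [N] using hp⟩
    · right
      simpa using hj
  by_contra! hS
  have hb : r < b := by simpa using hS ∅
  -- With `d` dummy rows adjacent to every column, the failure of `hS` is Hall's condition. At most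
  -- `d` columns are matched to dummies, so at least `r + 1` are matched inside `P`.
  let d := b - r - 1
  let t : Fin b → Finset (Fin a ⊕ Fin d) := fun j => (N j).disjSum Finset.univ
  have hall : ∀ S : Finset (Fin b), S.card ≤ (S.biUnion t).card := by
    intro S
    rcases S.eq_empty_or_nonempty with rfl | hne
    · simp
    · have ht : S.biUnion t = (S.biUnion N).disjSum Finset.univ := by
        ext x
        rcases x with x | x
        · simp [t]
        · simpa [t, Finset.Nonempty] using hne
      have h1 := hS S
      have h2 : S.card ≤ b := by simpa using S.card_le_univ
      rw [ht, Finset.card_disjSum, Finset.card_univ, Fintype.card_fin]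
      omega
  obtain ⟨f, hf, hft⟩ := (Finset.all_card_le_biUnion_card_iff_exists_injective t).1 hall
  let S : Finset (Fin b) := Finset.univ.filter fun j => (f j).isLeft
  have hrow : ∀ s : S, ∃ i, f s = Sum.inl i := by
    rintro ⟨s, hs⟩
    exact Sum.isLeft_iff.1 (by simpa [S] using hs)
  choose row hrow using hrow
  have hle := h S row (fun s s' hss => Subtype.ext (hf (by rw [hrow, hrow, hss]))) (by
    intro s
    have := hft s
    rw [hrow s] at this
    simpa [t, N] using this)
  have hcompl : (Sᶜ).card ≤ d := by
    have himg : (Sᶜ).image f ⊆ (Finset.univ : Finset (Fin d)).image Sum.inr := by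
      intro x hx
      obtain ⟨j, hj, rfl⟩ := Finset.mem_image.1 hx
      have : (f j).isLeft = false := by simpa [S] using hj
      rcases hfj : f j with y | y
      · simp [hfj] at this
      · simp
    have h1 := Finset.card_le_card himg
    rw [Finset.card_image_of_injective _ hf] at h1
    exact h1.trans (Finset.card_image_le.trans (by simp))
  rw [Finset.card_compl, Fintype.card_fin] at hcompl
  omega

theorem exists_cover_leadingPositions (A : Submodule F (Matrix (Fin a) (Fin b) F)) :
    ∃ (I : Finset (Fin a)) (J : Finset (Fin b)), I.card + J.card ≤ maxRank A ∧
      ∀ p ∈ leadingPositions A, p.1 ∈ I ∨ p.2 ∈ J := by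
  refine exists_cover_of_matching_le _ fun S row hrow h => ?_
  simpa using card_le_maxRank_of_matching A row (fun t : S => (t : Fin b)) hrow
    Subtype.val_injective h

theorem ncard_le_of_cover {P : Set (Fin a × Fin b)} {I : Finset (Fin a)} {J : Finset (Fin b)}
    (h : ∀ p ∈ P, p.1 ∈ I ∨ p.2 ∈ J) : P.ncard ≤ I.card * (b - J.card) + a * J.card := by
  classical
  have hsub : P ⊆ ((I ×ˢ Jᶜ ∪ Finset.univ ×ˢ J : Finset (Fin a × Fin b)) : Set _) := by
    intro p hp
    have := h p hp
    by_cases hJ : p.2 ∈ J <;> simp_all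
  calc P.ncard ≤ (I ×ˢ Jᶜ ∪ Finset.univ ×ˢ J).card := by
        rw [← Set.ncard_coe_finset]
        exact Set.ncard_le_ncard hsub (Finset.finite_toSet _)
    _ ≤ (I ×ˢ Jᶜ).card + (Finset.univ ×ˢ J).card := Finset.card_union_le _ _
    _ = _ := by simp [Finset.card_product, Finset.card_compl]

/-- The anticode bound. -/
theorem finrank_le_mul_maxRank (hba : b ≤ a) (A : Submodule F (Matrix (Fin a) (Fin b) F)) :
    Module.finrank F A ≤ a * maxRank A := by
  obtain ⟨I, J, hIJ, hP⟩ := exists_cover_leadingPositions A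
  calc Module.finrank F A ≤ _ := (finrank_le_ncard_leadingPositions A).trans (ncard_le_of_cover hP)
    _ ≤ I.card * a + a * J.card := by gcongr; omega
    _ = a * (I.card + J.card) := by ring
    _ ≤ a * maxRank A := by gcongr

/-- The elements of an optimal anticode are determined by `maxRank A` of their columns, or, if the
matrices are square, by `maxRank A` of their rows. -/
theorem IsOptimalAnticode.exists_columns_or_rows (hba : b ≤ a) (ha : 0 < a)
    {A : Submodule F (Matrix (Fin a) (Fin b) F)} (hA : IsOptimalAnticode A) :
    (∃ J : Finset (Fin b), J.card ≤ maxRank A ∧ ∀ M ∈ A, (∀ i, ∀ j ∈ J, M i j = 0) → M = 0) ∨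
    (a = b ∧ ∃ I : Finset (Fin a), I.card ≤ maxRank A ∧
      ∀ M ∈ A, (∀ i ∈ I, ∀ j, M i j = 0) → M = 0) := by
  obtain ⟨I, J, hIJ, hP⟩ := exists_cover_leadingPositions A
  have h1 := (finrank_le_ncard_leadingPositions A).trans (ncard_le_of_cover hP)
  rw [hA] at h1
  have hmul : a * (I.card + J.card) ≤ a * maxRank A := by gcongr
  -- Optimality leaves no slack in the count: each row of `I` must account for `a` positions
  -- although it has only `b - J.card` outside `J`. Hence `I` is empty, or `J` is empty and `a = b`.
  have h2 : I.card * a ≤ I.card * (b - J.card) := by nlinarith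
  rcases Nat.eq_zero_or_pos I.card with hI | hI
  · left
    refine ⟨J, by omega, fun M hM h0 => ?_⟩
    by_contra hne
    obtain ⟨p, hp, hp'⟩ := exists_leadingPosition hM hne
    rcases hP p hp with h | h
    · simp [Finset.card_eq_zero.1 hI] at h
    · exact hp' (h0 _ _ h)
  · right
    have h3 : a ≤ b - J.card := Nat.le_of_mul_le_mul_left h2 hI
    have hJ : J.card = 0 := by omega
    refine ⟨by omega, I, by omega, fun M hM h0 => ?_⟩
    by_contra hne
    obtain ⟨p, hp, hp'⟩ := exists_leadingPosition hM hne
    rcases hP p hp with h | h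
    · exact hp' (h0 _ h _)
    · simp [Finset.card_eq_zero.1 hJ] at h

/-! ### Optimal anticodes determined by their columns. -/

/-- Two independent vectors are the values at two prescribed indices of an independent family. -/
theorem exists_linearIndependent_extend {K V ι : Type*} [Field K] [AddCommGroup V] [Module K V]
    [FiniteDimensional K V] [Fintype ι] (hι : Fintype.card ι ≤ Module.finrank K V) {p q : ι}
    (hpq : p ≠ q) {x y : V} (hxy : LinearIndependent K ![x, y]) :
    ∃ z : ι → V, LinearIndependent K z ∧ z p = x ∧ z q = y := by
  classical
  let B := Module.Basis.sumExtend hxy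
  have : Finite (Fin 2 ⊕ Module.Basis.sumExtendIndex hxy) := Module.Finite.finite_basis B
  let _ := Fintype.ofFinite (Fin 2 ⊕ Module.Basis.sumExtendIndex hxy)
  have hcard : Module.finrank K V = Fintype.card (Fin 2 ⊕ Module.Basis.sumExtendIndex hxy) :=
    Module.finrank_eq_card_basis B
  have hB : ∀ i, B (Sum.inl i) = ![x, y] i := fun i => by
    simp only [B, Module.Basis.sumExtend, Module.Basis.reindex_apply, Module.Basis.extend_apply_self]
    rfl
  let f : ι → Fin 2 ⊕ Module.Basis.sumExtendIndex hxy :=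
    fun i => if i = p then Sum.inl 0 else Sum.inl 1
  obtain ⟨t, ht, htc⟩ := Finset.exists_superset_card_eq
    (s := ({p, q} : Finset ι).image f) (n := Fintype.card ι)
    ((Finset.card_image_le).trans (Finset.card_le_univ _)) (by omega)
  obtain ⟨g, hg⟩ := Finset.exists_equiv_extend_of_card_eq htc.symm ht (by
    intro i hi j hj hij
    simp only [Finset.coe_insert, Finset.coe_singleton, Set.mem_insert_iff,
      Set.mem_singleton_iff] at hi hj
    rcases hi with rfl | rfl <;> rcases hj with rfl | rfl <;> simp_all [f])
  refine ⟨fun i => B (g i), B.linearIndependent.comp _ ?_, ?_, ?_⟩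
  · exact Subtype.val_injective.comp g.injective
  · have h := hg p (by simp)
    simp [h, f, hB]
  · have h := hg q (by simp)
    simp [h, f, hB, hpq.symm]

/-- A linear map on families of `r` vectors of a space of dimension larger than `r`, whose value on
each independent family lies in its span, forms a fixed linear combination. -/
theorem exists_eq_sum_smul_of_mem_span {K V ι : Type*} [Field K] [AddCommGroup V] [Module K V]
    [FiniteDimensional K V] [Fintype ι] (hι : Fintype.card ι < Module.finrank K V)
    (φ : (ι → V) →ₗ[K] V)
    (h : ∀ X : ι → V, LinearIndependent K X → φ X ∈ Submodule.span K (Set.range X)) :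
    ∃ v : ι → K, ∀ X, φ X = ∑ k, v k • X k := by
  classical
  -- Suppose `x` and its image `y` are independent. Choose an independent `X` with `X k' = x` and
  -- `y` outside its span. Adding `x` to `X k` keeps independence and span, yet changes `φ X` by
  -- `y`. With a single index, the hypothesis applies to `x` directly.
  have key : ∀ k x, ¬ LinearIndependent K ![x, φ (Pi.single k x)] := by
    intro k x hxy
    set y := φ (Pi.single k x) with hy
    by_cases hk : ∃ k', k' ≠ k
    · obtain ⟨k', hk'⟩ := hk
      obtain ⟨z, hz, hzx, hzy⟩ := exists_linearIndependent_extend (ι := Option ι)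
        (p := some k') (q := none) (by simpa using hι) (by simp) hxy
      let X : ι → V := fun i => z (some i)
      have hX : LinearIndependent K X := hz.comp _ (Option.some_injective _)
      have hX' : LinearIndependent K (X + Pi.single k x) := by
        have h1 := (linearIndependent_add_smul_iff
          (v := X) (c := Pi.single k 1) (i := k') (by simp [hk'])).2 hX
        have h2 : X + Pi.single k x = X + fun i => (Pi.single k 1 : ι → K) i • X k' := by
          ext i
          by_cases hi : i = k
          · subst hi
            simp [X, hzx]
          · simp [hi]
        rwa [h2]
      have hspan : Submodule.span K (Set.range (X + Pi.single k x)) ≤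
          Submodule.span K (Set.range X) := by
        rw [Submodule.span_le]
        rintro _ ⟨i, rfl⟩
        refine Submodule.add_mem _ (Submodule.subset_span ⟨i, rfl⟩) ?_
        by_cases hi : i = k
        · subst hi
          rw [Pi.single_eq_same]
          exact Submodule.subset_span ⟨k', hzx⟩
        · rw [Pi.single_eq_of_ne hi]
          exact Submodule.zero_mem _
      have hmem : y ∈ Submodule.span K (Set.range X) := by
        have h1 := Submodule.sub_mem _ (hspan (h _ hX')) (h _ hX)
        rwa [map_add, add_sub_cancel_left] at h1
      have hnot := hz.notMem_span_image (s := Set.range some) (x := none) (by simp)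
      rw [← Set.range_comp, hzy] at hnot
      exact hnot hmem
    · push Not at hk
      have : Unique ι := ⟨⟨k⟩, hk⟩
      have hx : x ≠ 0 := hxy.ne_zero 0
      have h1 := h (Pi.single k x) (by
        rw [linearIndependent_unique_iff]
        rw [hk default]
        simpa using hx)
      rw [Set.range_unique, Submodule.mem_span_singleton] at h1
      obtain ⟨c, hc⟩ := h1
      have hkx : (Pi.single k x : ι → V) default = x := by
        rw [hk default, Pi.single_eq_same]
      rw [hkx] at hc
      exact (LinearIndependent.pair_iff' hx).1 hxy c (by convert hc)
  have h2 : ∀ k, ∃ c : K, φ ∘ₗ LinearMap.single K (fun _ => V) k = c • 1 := fun k =>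
    LinearMap.exists_eq_smul_id_of_forall_notLinearIndependent (key k)
  choose v hv using h2
  refine ⟨v, fun X => ?_⟩
  conv_lhs => rw [← Finset.univ_sum_single X]
  rw [map_sum]
  exact Finset.sum_congr rfl fun k _ => LinearMap.congr_fun (hv k) (X k)

/-- Independent columns at least as numerous as the rank already span the column space. -/
theorem col_mem_span_range_of_rank_le {ι : Type*} (M : Matrix (Fin a) (Fin b) F)
    (c : ι → Fin b) {X : ι → Fin a → F} (hX : ∀ k, X k = M.col (c k)) (j : Fin b)
    [Fintype ι] (hli : LinearIndependent F X) (hr : M.rank ≤ Fintype.card ι) :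
    M.col j ∈ Submodule.span F (Set.range X) := by
  have hle : Submodule.span F (Set.range X) ≤ Submodule.span F (Set.range M.col) := by
    refine Submodule.span_mono ?_
    rintro _ ⟨k, rfl⟩
    exact ⟨c k, (hX k).symm⟩
  have heq := Submodule.eq_of_le_of_finrank_le hle (by
    rw [finrank_span_eq_card hli, ← rank_eq_finrank_span_cols]
    exact hr)
  rw [heq]
  exact Submodule.subset_span ⟨j, rfl⟩

/-- If the elements of an optimal anticode are determined by `maxRank A` of their columns, then
they arise from these columns by multiplication with a fixed matrix. -/
theorem IsOptimalAnticode.exists_eq_mul (hba : b ≤ a)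
    {A : Submodule F (Matrix (Fin a) (Fin b) F)} (hA : IsOptimalAnticode A)
    (J : Finset (Fin b)) (hJ : J.card ≤ maxRank A)
    (hinj : ∀ M ∈ A, (∀ i, ∀ j ∈ J, M i j = 0) → M = 0) :
    ∃ V : Matrix J (Fin b) F, ∀ M ∈ A, M = M.submatrix id (fun j : J => (j : Fin b)) * V := by
  classical
  let π : A →ₗ[F] (J → Fin a → F) :=
    { toFun := fun M k i => M.1 i k
      map_add' := fun _ _ => rfl
      map_smul' := fun _ _ => rfl }
  have hπ : Function.Injective π := by
    rw [← LinearMap.ker_eq_bot, LinearMap.ker_eq_bot']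
    rintro ⟨M, hM⟩ h
    exact Subtype.ext (hinj M hM fun i j hj => congrFun (congrFun h ⟨j, hj⟩) i)
  have hdim : Module.finrank F (J → Fin a → F) = J.card * a := by
    simp [Module.finrank_pi_fintype]
  have hle := LinearMap.finrank_le_finrank_of_injective hπ
  -- Optimality makes the projection to the columns in `J` bijective, so these columns can be
  -- prescribed freely.
  have hfin : Module.finrank F A = Module.finrank F (J → Fin a → F) := by
    refine le_antisymm hle ?_
    rw [hdim, hA, mul_comm]
    gcongr
  let e := LinearEquiv.ofInjectiveOfFinrankEq π hπ hfin
  have he : ∀ M : A, e.symm (fun k i => M.1 i k) = M := fun M => e.symm_apply_apply M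
  have hcol : ∀ (X : J → Fin a → F) (k : J) i, (e.symm X).1 i k = X k i := fun X k i =>
    congrFun (congrFun (e.apply_symm_apply X) k) i
  have hv : ∀ j : Fin b, ∃ v : J → F, ∀ M ∈ A, ∀ i, M i j = ∑ k, v k * M i k := by
    intro j
    by_cases hj : j ∈ J
    · refine ⟨Pi.single ⟨j, hj⟩ 1, fun M _ i => ?_⟩
      simp [Pi.single_apply]
    · have hJa : Fintype.card J < Module.finrank F (Fin a → F) := by
        have : J.card < b := by
          simpa using Finset.card_lt_univ_of_notMem hj
        simp
        omega
      by_cases hr : J.card = maxRank A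
      · let φ : (J → Fin a → F) →ₗ[F] (Fin a → F) :=
          { toFun := fun X i => (e.symm X).1 i j
            map_add' := fun X Y => by ext i; simp
            map_smul' := fun c X => by ext i; simp }
        obtain ⟨v, hv⟩ := exists_eq_sum_smul_of_mem_span hJa φ (fun X hX =>
          col_mem_span_range_of_rank_le (e.symm X).1 (fun k : J => (k : Fin b))
            (fun k => funext fun i => (hcol X k i).symm) j hX (by
              simpa [hr] using rank_le_maxRank (e.symm X).2))
        refine ⟨v, fun M hM i => ?_⟩
        have h1 := congrFun (hv fun k i => M i k) i
        have h2 := he ⟨M, hM⟩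
        simpa [φ, h2] using h1
      -- The two dimensions `a * maxRank A` and `J.card * a` agree, so the sizes can differ only
      -- when there are no rows.
      · have ha : a = 0 := by
          rw [hdim, hA] at hfin
          by_contra ha
          apply hr
          rw [mul_comm] at hfin
          exact (Nat.eq_of_mul_eq_mul_right (Nat.pos_of_ne_zero ha) hfin).symm
        subst ha
        exact ⟨0, fun M _ i => i.elim0⟩
  choose v hv using hv
  refine ⟨Matrix.of fun k j => v j k, fun M hM => ?_⟩
  ext i j
  rw [hv j M hM i]
  simp [Matrix.mul_apply, mul_comm]

theorem rank_submatrix_le_of_column_eq_zero {ι : Type*} [Fintype ι] (X : Matrix (Fin a) ι F)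
    (k : ι) (h : ∀ i, X i k = 0) : X.rank ≤ Fintype.card ι - 1 := by
  classical
  rw [rank_eq_finrank_span_cols]
  have hle : Submodule.span F (Set.range X.col) ≤
      Submodule.span F (((Finset.univ.erase k).image X.col : Finset (Fin a → F)) : Set _) := by
    rw [Submodule.span_le]
    rintro _ ⟨j, rfl⟩
    by_cases hj : j = k
    · have : X.col j = 0 := by
        ext i
        simp [hj, h]
      rw [this]
      exact Submodule.zero_mem _
    · exact Submodule.subset_span (by
        rw [Finset.mem_coe, Finset.mem_image]
        exact ⟨j, by simp [hj], rfl⟩)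
  calc _ ≤ _ := Submodule.finrank_mono hle
    _ ≤ _ := finrank_span_finset_le_card _
    _ ≤ (Finset.univ.erase k).card := Finset.card_image_le
    _ = _ := by simp [Finset.card_erase_of_mem]

/-! ### Lowering the maximum rank of an optimal anticode. -/

/-- A subspace of small codimension and small maximum rank in an optimal anticode is an optimal
anticode. -/
theorem IsOptimalAnticode.of_codim (hba : b ≤ a) (ha : 0 < a)
    {A A' : Submodule F (Matrix (Fin a) (Fin b) F)} (hA : IsOptimalAnticode A) {r : ℕ}
    (hr : maxRank A = r + 1) (hcodim : Module.finrank F A ≤ Module.finrank F A' + a)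
    (hr' : maxRank A' ≤ r) : IsOptimalAnticode A' ∧ maxRank A' = r := by
  have h1 := finrank_le_mul_maxRank hba A'
  rw [hA, hr] at hcodim
  have h2 : maxRank A' = r := by
    refine le_antisymm hr' ?_
    refine Nat.le_of_mul_le_mul_left (c := a) ?_ ha
    linarith
  refine ⟨?_, h2⟩
  rw [IsOptimalAnticode]
  rw [h2] at h1 ⊢
  linarith

/-- Requiring one column of `J` to vanish imposes at most `a` conditions. Since every element
factors through its columns in `J`, its rank is then at most `J.card - 1`. -/
theorem IsOptimalAnticode.exists_sub_of_columns (hba : b ≤ a) (ha : 0 < a)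
    {A : Submodule F (Matrix (Fin a) (Fin b) F)} (hA : IsOptimalAnticode A) {r : ℕ}
    (hr : maxRank A = r + 1) (J : Finset (Fin b)) (hJ : J.card ≤ maxRank A)
    (hinj : ∀ M ∈ A, (∀ i, ∀ j ∈ J, M i j = 0) → M = 0) :
    ∃ A' ≤ A, IsOptimalAnticode A' ∧ maxRank A' = r := by
  obtain ⟨V, hV⟩ := hA.exists_eq_mul hba J hJ hinj
  have hne : J.Nonempty := by
    by_contra h
    rw [Finset.not_nonempty_iff_eq_empty] at h
    subst h
    have h0 : ∀ M ∈ A, M.rank ≤ 0 := fun M hM => by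
      rw [hinj M hM (by simp), rank_zero]
    have := maxRank_le h0
    omega
  obtain ⟨j, hj⟩ := hne
  let f : A →ₗ[F] (Fin a → F) :=
    { toFun := fun M i => M.1 i j
      map_add' := fun _ _ => rfl
      map_smul' := fun _ _ => rfl }
  refine ⟨(LinearMap.ker f).map A.subtype, Submodule.map_subtype_le _ _,
    hA.of_codim hba ha hr ?_ ?_⟩
  · have h1 := f.finrank_range_add_finrank_ker
    have h2 := (LinearMap.range f).finrank_le
    rw [Module.finrank_fin_fun] at h2
    rw [Submodule.finrank_map_subtype_eq]
    omega
  · refine maxRank_le ?_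
    rintro _ ⟨⟨M, hM⟩, hM0, rfl⟩
    have h0 : ∀ i, M i j = 0 := fun i => congrFun hM0 i
    change M.rank ≤ r
    rw [hV M hM]
    refine (rank_mul_le_left _ _).trans ?_
    refine (rank_submatrix_le_of_column_eq_zero _ ⟨j, hj⟩ h0).trans ?_
    rw [Fintype.card_coe]
    omega

theorem maxRank_map_transpose {A : Submodule F (Matrix (Fin a) (Fin b) F)} :
    maxRank (A.map (transposeLinearEquiv (Fin a) (Fin b) F F).toLinearMap) = maxRank A := by
  refine congrArg sSup (Set.ext fun k => ⟨?_, ?_⟩)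
  · rintro ⟨_, ⟨M, hM, rfl⟩, hk⟩
    exact ⟨M, hM, by rw [← hk]; exact (rank_transpose M).symm⟩
  · rintro ⟨M, hM, hk⟩
    exact ⟨_, ⟨M, hM, rfl⟩, by rw [← hk]; exact rank_transpose M⟩

theorem IsOptimalAnticode.map_transpose {A : Submodule F (Matrix (Fin a) (Fin a) F)}
    (hA : IsOptimalAnticode A) :
    IsOptimalAnticode (A.map (transposeLinearEquiv (Fin a) (Fin a) F F).toLinearMap) := by
  rw [IsOptimalAnticode, maxRank_map_transpose, ← hA]
  exact LinearEquiv.finrank_map_eq _ _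

/-- An optimal anticode contains an optimal anticode of maximum rank smaller by one. -/
theorem IsOptimalAnticode.exists_sub_pred (hba : b ≤ a) (ha : 0 < a)
    {A : Submodule F (Matrix (Fin a) (Fin b) F)} (hA : IsOptimalAnticode A) {r : ℕ}
    (hr : maxRank A = r + 1) : ∃ A' ≤ A, IsOptimalAnticode A' ∧ maxRank A' = r := by
  rcases hA.exists_columns_or_rows hba ha with ⟨J, hJ, hinj⟩ | ⟨rfl, I, hI, hinj⟩
  · exact hA.exists_sub_of_columns hba ha hr J hJ hinj
  -- For square matrices transposition turns the determining rows into columns and preserves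
  -- optimality.
  · obtain ⟨B, hB, hBo, hBr⟩ := hA.map_transpose.exists_sub_of_columns le_rfl ha
      (by rw [maxRank_map_transpose, hr]) I (by rwa [maxRank_map_transpose]) (by
        rintro _ ⟨M, hM, rfl⟩ h
        rw [hinj M hM fun i hi j => h j i hi]
        simp)
    refine ⟨_, ?_, hBo.map_transpose, by rw [maxRank_map_transpose, hBr]⟩
    rintro _ ⟨M, hM, rfl⟩
    obtain ⟨N, hN, rfl⟩ := hB hM
    exact hN

theorem IsOptimalAnticode.exists_sub (hba : b ≤ a) (ha : 0 < a)
    {A : Submodule F (Matrix (Fin a) (Fin b) F)} (hA : IsOptimalAnticode A) (t : ℕ)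
    (ht : t ≤ maxRank A) :
    ∃ A' ≤ A, IsOptimalAnticode A' ∧ maxRank A' + t = maxRank A := by
  induction t with
  | zero => exact ⟨A, le_rfl, hA, rfl⟩
  | succ t ih =>
    obtain ⟨B, hB, hBo, hBr⟩ := ih (by omega)
    obtain ⟨B', hB', hBo', hBr'⟩ := hBo.exists_sub_pred hba ha (r := maxRank A - t - 1) (by omega)
    exact ⟨B', hB'.trans hB, hBo', by omega⟩

/-! ### Row space anticodes and products. -/

/-- The space of all matrices whose row space is contained in the row space of `X`. -/
def rowSpaceAnticode (X : Matrix (Fin a) (Fin b) F) : Submodule F (Matrix (Fin a) (Fin b) F) :=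
  Submodule.pi Set.univ fun _ => Submodule.span F (Set.range X.row)

/-- A product of subspaces is the direct product of these subspaces. -/
def piSubmoduleEquiv {R ι : Type*} {V : ι → Type*} [Semiring R] [∀ i, AddCommMonoid (V i)]
    [∀ i, Module R (V i)] (p : ∀ i, Submodule R (V i)) :
    Submodule.pi Set.univ p ≃ₗ[R] (∀ i, p i) where
  toFun x i := ⟨x.1 i, x.2 i trivial⟩
  invFun y := ⟨fun i => y i, fun i _ => (y i).2⟩
  map_add' _ _ := rfl
  map_smul' _ _ := rfl
  left_inv _ := rfl
  right_inv _ := rfl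

theorem finrank_submodule_pi {K ι : Type*} {V : ι → Type*} [Field K] [Fintype ι]
    [∀ i, AddCommGroup (V i)] [∀ i, Module K (V i)] [∀ i, FiniteDimensional K (V i)]
    (p : ∀ i, Submodule K (V i)) :
    Module.finrank K (Submodule.pi Set.univ p) = ∑ i, Module.finrank K (p i) := by
  rw [(piSubmoduleEquiv p).finrank_eq, Module.finrank_pi_fintype]

theorem mem_rowSpaceAnticode (X : Matrix (Fin a) (Fin b) F) : X ∈ rowSpaceAnticode X :=
  fun i _ => Submodule.subset_span ⟨i, rfl⟩

theorem maxRank_rowSpaceAnticode (X : Matrix (Fin a) (Fin b) F) :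
    maxRank (rowSpaceAnticode X) = X.rank := by
  refine le_antisymm (maxRank_le fun M hM => ?_) (rank_le_maxRank (mem_rowSpaceAnticode X))
  rw [rank_eq_finrank_span_row, rank_eq_finrank_span_row]
  refine Submodule.finrank_mono (Submodule.span_le.2 ?_)
  rintro _ ⟨i, rfl⟩
  exact hM i trivial

theorem isOptimalAnticode_rowSpaceAnticode (X : Matrix (Fin a) (Fin b) F) :
    IsOptimalAnticode (rowSpaceAnticode X) := by
  rw [IsOptimalAnticode, maxRank_rowSpaceAnticode, rank_eq_finrank_span_row]
  refine (finrank_submodule_pi (K := F) (V := fun _ : Fin a => Fin b → F) _).trans ?_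
  simp

variable {ℓ : ℕ} {m n : Fin ℓ → ℕ}

theorem srk_le_maxSrk {C : Submodule F (Ambient F m n)} {X : Ambient F m n} (hX : X ∈ C) :
    srk X ≤ maxSrk C :=
  (isGreatest_maxSrk C).2 ⟨X, hX, rfl⟩

theorem maxSrk_pi (A : (i : Fin ℓ) → Submodule F (Matrix (Fin (m i)) (Fin (n i)) F)) :
    maxSrk (Submodule.pi Set.univ A) = ∑ i, maxRank (A i) := by
  refine le_antisymm ?_ ?_
  · obtain ⟨X, hX, h⟩ := (isGreatest_maxSrk (Submodule.pi Set.univ A)).1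
    rw [← h]
    exact Finset.sum_le_sum fun i _ => rank_le_maxRank (hX i trivial)
  · choose X hX h using fun i => (isGreatest_maxRank (A i)).1
    calc ∑ i, maxRank (A i) = srk (m := m) (n := n) X := Finset.sum_congr rfl fun i _ => (h i).symm
      _ ≤ maxSrk (Submodule.pi Set.univ A) :=
          srk_le_maxSrk (X := X) (show X ∈ Submodule.pi Set.univ A from fun i _ => hX i)

theorem srk_le_sum (X : Ambient F m n) : srk X ≤ ∑ i, n i :=
  Finset.sum_le_sum fun i _ => (X i).rank_le_width

/-! ### Generalized weights. -/

theorem genWeight_le_of_mem {C : Submodule F (Ambient F m n)} {r k : ℕ}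
    (h : k ∈ weightSet C r) : genWeight C r ≤ k :=
  Nat.sInf_le h

/-- The row space anticodes of the blocks of a minimum weight codeword contain it and have its ranks
as maximum ranks. Conversely, any nonzero codeword in a product of anticodes bounds its maximum from
below. -/
theorem genWeight_one (hnm : ∀ i, n i ≤ m i) (C : Submodule F (Ambient F m n)) (hC : C ≠ ⊥) :
    genWeight C 1 = minDist C := by
  have hpos : 1 ≤ Module.finrank F C := Submodule.one_le_finrank_iff.2 hC
  refine le_antisymm ?_ ?_
  · obtain ⟨X, hX, h0, hk⟩ := (isLeast_minDist C hC).1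
    refine genWeight_le_of_mem ⟨fun i => rowSpaceAnticode (X i),
      fun i => isOptimalAnticode_rowSpaceAnticode _, ?_, ?_⟩
    · rw [Submodule.one_le_finrank_iff]
      exact (Submodule.ne_bot_iff _).2 ⟨X, ⟨hX, fun i _ => mem_rowSpaceAnticode (X i)⟩, h0⟩
    · rw [maxSrk_pi, ← hk]
      exact Finset.sum_congr rfl fun i _ => maxRank_rowSpaceAnticode (X i)
  · obtain ⟨A, -, hr, hk⟩ := (isLeast_genWeight hnm C hpos).1
    obtain ⟨X, hX, h0⟩ := (Submodule.ne_bot_iff _).1 (Submodule.one_le_finrank_iff.1 hr)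
    rw [← hk]
    exact ((isLeast_minDist C hC).2 ⟨X, hX.1, h0, rfl⟩).trans (srk_le_maxSrk hX.2)

theorem genWeight_mono (hnm : ∀ i, n i ≤ m i) (C : Submodule F (Ambient F m n)) {r s : ℕ}
    (hrs : r ≤ s) (hs : s ≤ Module.finrank F C) : genWeight C r ≤ genWeight C s := by
  obtain ⟨A, hA, hr, hk⟩ := (isLeast_genWeight hnm C hs).1
  exact genWeight_le_of_mem ⟨A, hA, hrs.trans hr, hk⟩

theorem genWeight_anti (hnm : ∀ i, n i ≤ m i) {C D : Submodule F (Ambient F m n)} (hCD : C ≤ D)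
    {r : ℕ} (hs : r ≤ Module.finrank F C) : genWeight D r ≤ genWeight C r := by
  obtain ⟨A, hA, hr, hk⟩ := (isLeast_genWeight hnm C hs).1
  exact genWeight_le_of_mem
    ⟨A, hA, hr.trans (Submodule.finrank_mono (inf_le_inf_right _ hCD)), hk⟩

theorem genWeight_le_sum (hnm : ∀ i, n i ≤ m i) (C : Submodule F (Ambient F m n)) {r : ℕ}
    (hr : r ≤ Module.finrank F C) : genWeight C r ≤ ∑ i, n i := by
  obtain ⟨A, -, -, hk⟩ := (isLeast_genWeight hnm C hr).1
  obtain ⟨X, -, hX⟩ := (isGreatest_maxSrk (Submodule.pi Set.univ A)).1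
  rw [← hk, ← hX]
  exact srk_le_sum X

theorem exists_le_sum_eq {ι : Type*} [Fintype ι] (ρ : ι → ℕ) (k : ℕ) (hk : k ≤ ∑ i, ρ i) :
    ∃ τ : ι → ℕ, (∀ i, τ i ≤ ρ i) ∧ ∑ i, τ i = k := by
  classical
  induction k with
  | zero => exact ⟨0, fun i => Nat.zero_le _, by simp⟩
  | succ k ih =>
    obtain ⟨τ, hτ, hs⟩ := ih (by omega)
    obtain ⟨i, -, hi⟩ := Finset.exists_lt_of_sum_lt (s := Finset.univ) (f := τ) (g := ρ) (by omega)
    refine ⟨τ + Pi.single i 1, fun j => ?_, ?_⟩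
    · by_cases hj : j = i
      · subst hj
        simpa using hi
      · simpa [hj] using hτ j
    · simp [Finset.sum_add_distrib, hs]

/-- For decreasing weights, a total of bounded multiplicities is largest if it is filled up from the
left. -/
theorem sum_mul_le_of_antitone (hm : Antitone m) (τ : Fin ℓ → ℕ) (hτ : ∀ i, τ i ≤ n i) (j : Fin ℓ)
    (δ : ℕ) (hs : ∑ i, τ i ≤ (∑ i ∈ Finset.Iio j, n i) + δ) :
    ∑ i, m i * τ i ≤ (∑ i ∈ Finset.Iio j, n i * m i) + δ * m j := by
  -- After subtracting `m j`, blocks from `j` on contribute at most zero, and earlier ones have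
  -- nonnegative weight. The subtracted part is controlled by `hs`.
  have h1 : ∑ i, ((m i : ℤ) - m j) * τ i ≤ ∑ i ∈ Finset.Iio j, ((m i : ℤ) - m j) * n i := by
    rw [← Finset.sum_filter_add_sum_filter_not Finset.univ (· < j)]
    have h2 : ∑ i with ¬ i < j, ((m i : ℤ) - m j) * τ i ≤ 0 := by
      refine Finset.sum_nonpos fun i hi => ?_
      have hle : m i ≤ m j := hm (not_lt.1 (Finset.mem_filter.1 hi).2)
      exact mul_nonpos_of_nonpos_of_nonneg (by omega) (by omega)
    have h3 : ∑ i with i < j, ((m i : ℤ) - m j) * τ i ≤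
        ∑ i ∈ Finset.Iio j, ((m i : ℤ) - m j) * n i := by
      have hIio : (Finset.univ.filter (· < j)) = Finset.Iio j := by
        ext i
        simp
      rw [hIio]
      refine Finset.sum_le_sum fun i hi => ?_
      have hle : m j ≤ m i := hm (Finset.mem_Iio.1 hi).le
      exact mul_le_mul_of_nonneg_left (by exact_mod_cast hτ i) (by omega)
    linarith
  simp only [sub_mul, Finset.sum_sub_distrib, ← Finset.mul_sum] at h1
  have h4 : (m j : ℤ) * ∑ i, (τ i : ℤ) ≤ m j * ((∑ i ∈ Finset.Iio j, (n i : ℤ)) + δ) :=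
    mul_le_mul_of_nonneg_left (by exact_mod_cast hs) (by omega)
  zify
  simp only [mul_comm (n _ : ℤ)]
  linarith

/-- The quotient of `C ⊓ A` by `C ⊓ A'` embeds in the quotient of `A` by `A'`. -/
theorem finrank_inf_le_add {K V : Type*} [Field K] [AddCommGroup V] [Module K V]
    [FiniteDimensional K V] (C : Submodule K V) {A A' : Submodule K V} (h : A' ≤ A) :
    Module.finrank K ↥(C ⊓ A) + Module.finrank K A' ≤
      Module.finrank K ↥(C ⊓ A') + Module.finrank K A := by
  have h1 := Submodule.finrank_sup_add_finrank_inf_eq (C ⊓ A) A'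
  rw [inf_assoc, inf_eq_right.2 h] at h1
  have h2 := Submodule.finrank_mono (sup_le (inf_le_right : C ⊓ A ≤ A) h)
  omega

theorem genWeight_add_le (hn : ∀ i, 0 < n i) (hnm : ∀ i, n i ≤ m i) (hm : Antitone m)
    (C : Submodule F (Ambient F m n)) (j : Fin ℓ) (δ r : ℕ) (hr : 1 ≤ r)
    (h : r + ((∑ i ∈ Finset.Iio j, n i * m i) + δ * m j) ≤ Module.finrank F C) :
    genWeight C r + ((∑ i ∈ Finset.Iio j, n i) + δ) ≤
      genWeight C (r + ((∑ i ∈ Finset.Iio j, n i * m i) + δ * m j)) := by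
  obtain ⟨A, hA, hdim, hk⟩ := (isLeast_genWeight hnm C h).1
  rw [← hk, maxSrk_pi]
  have hρ : ∀ i, maxRank (A i) ≤ n i := fun i => maxRank_le fun M _ => M.rank_le_width
  have hfin : ∀ B : (i : Fin ℓ) → Submodule F (Matrix (Fin (m i)) (Fin (n i)) F),
      (∀ i, IsOptimalAnticode (B i)) →
      Module.finrank F (Submodule.pi Set.univ B) = ∑ i, m i * maxRank (B i) := fun B hB => by
    rw [finrank_submodule_pi]
    exact Finset.sum_congr rfl fun i _ => hB i
  -- There is enough rank to remove: otherwise the cost bound, applied to the maximum ranks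
  -- themselves, makes the product too small, as `r ≥ 1`.
  have hle : (∑ i ∈ Finset.Iio j, n i) + δ ≤ ∑ i, maxRank (A i) := by
    by_contra! hlt
    have h1 := sum_mul_le_of_antitone hm _ hρ j δ hlt.le
    rw [← hfin A hA] at h1
    have h2 := Submodule.finrank_mono (inf_le_right : C ⊓ Submodule.pi Set.univ A ≤ _)
    have h3 := hdim.trans (h2.trans h1)
    omega
  obtain ⟨τ, hτ, hsum⟩ := exists_le_sum_eq _ _ hle
  choose A' hA' hopt hrank using fun i =>
    (hA i).exists_sub (hnm i) ((hn i).trans_le (hnm i)) (τ i) (hτ i)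
  have hA'A : Submodule.pi Set.univ A' ≤ Submodule.pi Set.univ A :=
    fun X hX i hi => hA' i (hX i hi)
  have hcost := sum_mul_le_of_antitone hm τ (fun i => (hτ i).trans (hρ i)) j δ hsum.le
  have hdim' := finrank_inf_le_add C hA'A
  rw [hfin A hA, hfin A' hopt] at hdim'
  have hsplit : ∑ i, m i * maxRank (A i) = ∑ i, m i * maxRank (A' i) + ∑ i, m i * τ i := by
    rw [← Finset.sum_add_distrib]
    exact Finset.sum_congr rfl fun i _ => by rw [← hrank i, mul_add]
  have hw : genWeight C r ≤ ∑ i, maxRank (A' i) :=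
    genWeight_le_of_mem ⟨A', hopt, by omega, maxSrk_pi A'⟩
  have hsplit' : ∑ i, maxRank (A i) = ∑ i, maxRank (A' i) + ∑ i, τ i := by
    rw [← Finset.sum_add_distrib]
    exact Finset.sum_congr rfl fun i _ => (hrank i).symm
  omega

end SumRank

theorem mainTheorem7 {F : Type*} [Field F] [Finite F] {ℓ : ℕ} (m n : Fin ℓ → ℕ)
    (hn : ∀ i, 0 < n i) (hnm : ∀ i, n i ≤ m i) (hm : Antitone m)
    (C D : Submodule F (SumRank.Ambient F m n)) (hC : C ≠ ⊥) (hCD : C ≤ D) :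
    SumRank.genWeight C 1 = SumRank.minDist C ∧
    (∀ r s : ℕ, 1 ≤ r → r ≤ s → s ≤ Module.finrank F C →
      SumRank.genWeight C r ≤ SumRank.genWeight C s) ∧
    (∀ r : ℕ, 1 ≤ r → r ≤ Module.finrank F C →
      SumRank.genWeight D r ≤ SumRank.genWeight C r) ∧
    SumRank.genWeight C (Module.finrank F C) ≤ ∑ i, n i ∧
    (∀ (j : Fin ℓ) (δ r : ℕ), δ < n j → 1 ≤ r →
      r + ((∑ i ∈ Finset.Iio j, n i * m i) + δ * m j) ≤ Module.finrank F C →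
      SumRank.genWeight C r + ((∑ i ∈ Finset.Iio j, n i) + δ) ≤
        SumRank.genWeight C (r + ((∑ i ∈ Finset.Iio j, n i * m i) + δ * m j))) := by
  exact ⟨SumRank.genWeight_one hnm C hC,
    fun r s _ hrs hs => SumRank.genWeight_mono hnm C hrs hs,
    fun r _ hr => SumRank.genWeight_anti hnm hCD hr,
    SumRank.genWeight_le_sum hnm C le_rfl,
    fun j δ r _ hr h => SumRank.genWeight_add_le hn hnm hm C j δ r hr h⟩
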